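/- \textbf{Theorem (Super-polynomial growth of the GPD).} Let $\mathbb{F}$ be a field, let $d\ge 2$ and $m\ge 0$ be integers, and give $\mathbb{R}^d$ the product order. There do not exist $k\in\mathbb{Z}_{\ge 0}$, $C\in\mathbb{R}$ and $N_0\in\mathbb{N}$ such that $$\|\mathrm{dgm}_m(\mathcal{F})\|\le C\,N^k$$ for every finite $d$-parameter simplicial filtration $\mathcal{F}$ with $N\ge N_0$ simplices whose $m$-th generalized persistence diagram $\mathrm{dgm}_m(\mathcal{F})$ exists and has finite support. In other words, for no $k$ is the size of the $m$-th generalized persistence diagram $O(N^k)$ over all finite $d$-parameter filtrations with $N$ simplices. Here the following definitions are used. (1) A \emph{finite $d$-parameter simplicial filtration} of a finite abstract simplicial complex $K$ is a monotone map $\mathcal{F}$ from $\mathbb{R}^d$ to the set of subcomplexes of $K$ ordered by inclusion, with $\mathcal{F}_p=K$ for some $p$, such that for every simplex $\sigma\in K$ there are finitely many points $q_1,\dots,q_t\in\mathbb{R}^d$ with: $\sigma\in\mathcal{F}_p$ if and only if $q_i\le p$ for some $i$. Its number of simplices is $N=|K|$. (2) An \emph{interval} of $\mathbb{R}^d$ is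 a nonempty subset $I$ that is convex ($p,q\in I$ and $p\le r\le q$ imply $r\in I$) and connected (any two points of $I$ are joined by a finite sequence in $I$ whose consecutive members are comparable). $\mathrm{Int}(\mathbb{R}^d)$ is the set of intervals. (3) For a functor $M$ from the poset $\mathbb{R}^d$ to $\mathbb{F}$-vector spaces and $I\in \mathrm{Int}(\mathbb{R}^d)$, the \emph{generalized rank} $\mathrm{rk}_M(I)$ is the rank of the canonical map $\varprojlim M|_I\to\varinjlim M|_I$, namely the composite $\varprojlim M|_I\to M(p)\to\varinjlim M|_I$ for any $p\in I$. (4) The \emph{generalized persistence diagram} (GPD) of $M$ is the function $\mathrm{dgm}_M:\mathrm{Int}(\mathbb{R}^d)\to\mathbb{Z}$, unique if it exists, such that for every interval $I$ one has $\mathrm{rk}_M(I)=\sum_{J\supseteq I}\mathrm{dgm}_M(J)$, the sum being over intervals $J$ and having only finitely many nonzero summands. The $m$-th GPD $\mathrm{dgm}_m(\mathcal{F})$ of $\mathcal{F}$ is the GPD of the simplicial homology $p\mapsto \mathrm{H}_m(\mathcal{F}_p;\mathbb{F})$, and its \emph{size} $\|\mathrm{dgm}_m(\mathcal{F})\|$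 is the number of intervals on which it is nonzero. -/

import Mathlib

open CategoryTheory CategoryTheory.Limits

universe u

namespace MultiPers

/-! ### Intervals of a poset -/

section Intervals

variable {P : Type} [PartialOrder P]

/-- An interval of a poset: a nonempty, convex subset, any two points of which are joined by a
finite sequence of points of the subset whose consecutive members are comparable. -/
structure IsInterval (I : Set P) : Prop where
  nonempty : I.Nonempty
  convex : ∀ p ∈ I, ∀ q ∈ I, ∀ r, p ≤ r → r ≤ q → r ∈ I
  connected : ∀ p ∈ I, ∀ q ∈ I,
    Relation.ReflTransGen (fun a b => b ∈ I ∧ (a ≤ b ∨ b ≤ a)) p q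

end Intervals

/-- The set of all intervals of `P`, ordered by inclusion. -/
abbrev Interval (P : Type) [PartialOrder P] : Type := {I : Set P // IsInterval I}

/-! ### The generalized rank invariant and the generalized persistence diagram -/

section GPD

variable {𝔽 : Type u} [Field 𝔽] {P : Type} [PartialOrder P]

/-- The restriction of a `P`-module to a subset of `P`. -/
abbrev restrict (M : P ⥤ ModuleCat.{u} 𝔽) (I : Set P) : I ⥤ ModuleCat.{u} 𝔽 :=
  (Subtype.mono_coe (· ∈ I)).functor ⋙ M

/-- The map from the limit to the colimit of `M` restricted to `I` which passes through the
point `p` of `I`. -/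
noncomputable def limitToColimit (M : P ⥤ ModuleCat.{u} 𝔽) (I : Set P) (p : I) :
    limit (restrict M I) ⟶ colimit (restrict M I) :=
  limit.π (restrict M I) p ≫ colimit.ι (restrict M I) p

theorem limitToColimit_of_le (M : P ⥤ ModuleCat.{u} 𝔽) (I : Set P) {p q : I} (h : p ≤ q) :
    limitToColimit M I p = limitToColimit M I q := by
  unfold limitToColimit
  rw [← limit.w (restrict M I) (homOfLE h), ← colimit.w (restrict M I) (homOfLE h),
    Category.assoc]

/-- On an interval the limit-to-colimit map does not depend on the chosen point. -/
theorem limitToColimit_eq (M : P ⥤ ModuleCat.{u} 𝔽) (I : Interval P) (p q : I.1) :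
    limitToColimit M I.1 p = limitToColimit M I.1 q := by
  obtain ⟨p, hp⟩ := p
  obtain ⟨q, hq⟩ := q
  induction I.2.connected p hp q hq with
  | refl => rfl
  | @tail b c hab hbc ih =>
    have hb : b ∈ I.1 := by
      rcases Relation.ReflTransGen.cases_tail hab with h | ⟨_, _, h⟩
      · exact h ▸ hp
      · exact h.1
    refine (ih hb).trans ?_
    rcases hbc.2 with h | h
    · exact limitToColimit_of_le M I.1 h
    · exact (limitToColimit_of_le M I.1 h).symm

/-- The generalized rank invariant: the rank of the canonical limit-to-colimit map of the
restriction of `M` to the interval `I`. -/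
noncomputable def genRank (M : P ⥤ ModuleCat.{u} 𝔽) (I : Interval P) : ℕ :=
  Module.finrank 𝔽
    (LinearMap.range (limitToColimit M I.1 ⟨I.2.nonempty.some, I.2.nonempty.some_mem⟩).hom)

/-- `g` is the generalized persistence diagram of `M`: for every interval `I`, the sum of `g` over
all intervals containing `I` has finitely many nonzero summands and equals the generalized rank
of `M` over `I`. -/
def IsGPD (M : P ⥤ ModuleCat.{u} 𝔽) (g : Interval P → ℤ) : Prop :=
  ∀ I : Interval P, {J : Interval P | I ≤ J ∧ g J ≠ 0}.Finite ∧
    (genRank M I : ℤ) = ∑ᶠ (J : Interval P) (_ : I ≤ J), g J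

/-- A module has at most one generalized persistence diagram. -/
theorem IsGPD.unique {M : P ⥤ ModuleCat.{u} 𝔽} {g h : Interval P → ℤ}
    (hg : IsGPD M g) (hh : IsGPD M h) : g = h := by
  by_contra hne
  obtain ⟨I, hI⟩ := Function.ne_iff.mp hne
  have hfin : {J : Interval P | I ≤ J ∧ g J ≠ h J}.Finite := by
    refine ((hg I).1.union (hh I).1).subset ?_
    rintro J ⟨hJ, hJne⟩
    by_cases h0 : g J = 0
    · exact Or.inr ⟨hJ, fun h1 => hJne (h0.trans h1.symm)⟩
    · exact Or.inl ⟨hJ, h0⟩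
  obtain ⟨J, hJ, hmax⟩ := hfin.exists_maximal ⟨I, le_refl I, hI⟩
  have key : ∑ᶠ (K : Interval P) (_ : J ≤ K), g K = ∑ᶠ (K : Interval P) (_ : J ≤ K), h K := by
    rw [← (hg J).2, ← (hh J).2]
  have fin1 : ∀ f : Interval P → ℤ, {K : Interval P | J ≤ K ∧ f K ≠ 0}.Finite →
      ∑ᶠ (K : Interval P) (_ : J ≤ K), f K = f J + ∑ᶠ (K : Interval P) (_ : J < K), f K := by
    intro f hf
    have hset : {K : Interval P | J ≤ K} = insert J {K : Interval P | J < K} := by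
      ext K
      simp [le_iff_eq_or_lt, eq_comm]
    have := finsum_mem_insert' (s := {K : Interval P | J < K}) (a := J) f (by simp)
      (hf.subset (by rintro K ⟨h1, h2⟩; exact ⟨le_of_lt h1, h2⟩))
    rw [← hset] at this
    exact this
  rw [fin1 g (hg J).1, fin1 h (hh J).1] at key
  have hrest : ∑ᶠ (K : Interval P) (_ : J < K), g K = ∑ᶠ (K : Interval P) (_ : J < K), h K := by
    refine finsum_congr fun K => finsum_congr fun hK => ?_
    by_contra hKne
    exact absurd (hmax ⟨hJ.1.trans hK.le, hKne⟩ hK.le) (not_le_of_gt hK)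
  rw [hrest] at key
  exact hJ.2 (add_right_cancel key)

end GPD

/-! ### Simplicial homology with coefficients in a field

A `PreAbstractSimplicialComplex V` is an abstract simplicial complex whose vertices are some of
the elements of `V`. Simplices are oriented by a linear order on `V`; an `m`-simplex has `m + 1`
vertices. Chains of all complexes on `V` are taken inside `Finset V →₀ 𝔽`. -/

section Subquotient

variable {𝔽 : Type u} [Field 𝔽] {A : Type u} [AddCommGroup A] [Module 𝔽 A]

/-- The quotient `Z / (B ∩ Z)` for submodules `Z` and `B`, that is `Z / B` when `B ≤ Z`. -/
noncomputable def subquotient (Z B : Submodule 𝔽 A) : ModuleCat.{u} 𝔽 :=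
  ModuleCat.of 𝔽 (Z ⧸ B.submoduleOf Z)

/-- The map of quotients induced by inclusions of submodules. -/
noncomputable def subquotientMap {Z B Z' B' : Submodule 𝔽 A} (hZ : Z ≤ Z') (hB : B ≤ B') :
    subquotient Z B ⟶ subquotient Z' B' :=
  ModuleCat.ofHom (Submodule.mapQ (B.submoduleOf Z) (B'.submoduleOf Z')
    (Submodule.inclusion hZ) fun _ hx => hB hx)

theorem subquotientMap_refl (Z B : Submodule 𝔽 A) :
    subquotientMap (le_refl Z) (le_refl B) = 𝟙 (subquotient Z B) :=
  ModuleCat.hom_ext (LinearMap.ext fun x => by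
    obtain ⟨x, rfl⟩ := Submodule.mkQ_surjective _ x
    rfl)

theorem subquotientMap_trans {Z B Z' B' Z'' B'' : Submodule 𝔽 A} (hZ : Z ≤ Z') (hB : B ≤ B')
    (hZ' : Z' ≤ Z'') (hB' : B' ≤ B'') :
    subquotientMap (hZ.trans hZ') (hB.trans hB') =
      subquotientMap hZ hB ≫ subquotientMap hZ' hB' :=
  ModuleCat.hom_ext (LinearMap.ext fun x => by
    obtain ⟨x, rfl⟩ := Submodule.mkQ_surjective _ x
    rfl)

end Subquotient

section Chains

variable (𝔽 : Type u) [Field 𝔽] {V : Type}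

/-- The space of `m`-chains of `K`. -/
noncomputable def chains (K : PreAbstractSimplicialComplex V) (m : ℕ) :
    Submodule 𝔽 (Finset V →₀ 𝔽) :=
  Finsupp.supported 𝔽 𝔽 {s | s ∈ K.faces ∧ s.card = m + 1}

variable {𝔽}

theorem chains_mono {K L : PreAbstractSimplicialComplex V} (h : K ≤ L) (m : ℕ) :
    chains 𝔽 K m ≤ chains 𝔽 L m :=
  Finsupp.supported_mono fun _ hs => ⟨h hs.1, hs.2⟩

end Chains

section Homology

variable (𝔽 : Type u) [Field 𝔽] {V : Type} [LinearOrder V]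

/-- The simplicial boundary operator, with `∂[v₀, …, vₘ] = ∑ i, (-1) ^ i [v₀, …, v̂ᵢ, …, vₘ]` for
`v₀ < … < vₘ` and `m ≥ 1`, and zero on vertices. -/
noncomputable def boundary : (Finset V →₀ 𝔽) →ₗ[𝔽] (Finset V →₀ 𝔽) :=
  Finsupp.linearCombination 𝔽 fun s : Finset V =>
    if s.card ≤ 1 then 0
    else ∑ v ∈ s, Finsupp.single (s.erase v) ((-1 : 𝔽) ^ (s.filter (· < v)).card)

/-- The space of `m`-cycles of `K`. -/
noncomputable def cycles (K : PreAbstractSimplicialComplex V) (m : ℕ) :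
    Submodule 𝔽 (Finset V →₀ 𝔽) :=
  chains 𝔽 K m ⊓ LinearMap.ker (boundary 𝔽)

/-- The space of `m`-boundaries of `K`. -/
noncomputable def boundaries (K : PreAbstractSimplicialComplex V) (m : ℕ) :
    Submodule 𝔽 (Finset V →₀ 𝔽) :=
  (chains 𝔽 K (m + 1)).map (boundary 𝔽)

theorem boundary_sign (s : Finset V) (v w : V) (hv : v ∈ s) (hw : w ∈ s) (hvw : v ≠ w) :
    (-1 : 𝔽) ^ (s.filter (· < v)).card * (-1 : 𝔽) ^ ((s.erase v).filter (· < w)).card +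
      (-1 : 𝔽) ^ (s.filter (· < w)).card * (-1 : 𝔽) ^ ((s.erase w).filter (· < v)).card = 0 := by
  wlog hlt : v < w generalizing v w
  · rw [add_comm]
    exact this w v hw hv hvw.symm (lt_of_le_of_ne (not_lt.mp hlt) hvw.symm)
  have h1 : (s.erase w).filter (· < v) = s.filter (· < v) := by
    rw [Finset.filter_erase, Finset.erase_eq_of_notMem]
    simp [hlt.le]
  have h2 : (s.filter (· < w)).card = ((s.erase v).filter (· < w)).card + 1 := by
    rw [Finset.filter_erase, Finset.card_erase_add_one]
    simp [hv, hlt]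
  rw [h1, h2]
  ring

/-- The boundary of a boundary is zero. -/
theorem boundary_boundary (c : Finset V →₀ 𝔽) : boundary 𝔽 (boundary 𝔽 c) = 0 := by
  suffices h : (boundary 𝔽).comp (boundary 𝔽) = (0 : (Finset V →₀ 𝔽) →ₗ[𝔽] (Finset V →₀ 𝔽)) from
    LinearMap.congr_fun h c
  refine Finsupp.lhom_ext fun s a => ?_
  rw [LinearMap.comp_apply, LinearMap.zero_apply, boundary, Finsupp.linearCombination_single,
    map_smul]
  split_ifs with hs
  · simp
  simp only [map_sum, Finsupp.linearCombination_single]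
  rw [Finset.sum_congr rfl (g := fun v => ∑ w ∈ s.erase v, if s.card ≤ 2 then 0 else
    (((-1 : 𝔽) ^ (s.filter (· < v)).card * (-1 : 𝔽) ^ ((s.erase v).filter (· < w)).card) •
      Finsupp.single ((s.erase v).erase w) (1 : 𝔽)))]
  · rw [Finset.sum_sigma']
    rw [Finset.sum_involution (fun x _ => ⟨x.2, x.1⟩), smul_zero]
    · rintro ⟨v, w⟩ h
      simp only [Finset.mem_sigma, Finset.mem_erase] at h
      split_ifs
      · simp
      rw [Finset.erase_right_comm (a := w), ← add_smul]
      rw [boundary_sign 𝔽 s v w h.1 h.2.2 (Ne.symm h.2.1), zero_smul]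
    · rintro ⟨v, w⟩ h _ h'
      simp only [Finset.mem_sigma, Finset.mem_erase] at h
      simp only [Sigma.mk.injEq] at h'
      exact h.2.1 h'.1
    · rintro ⟨v, w⟩ h
      simp only [Finset.mem_sigma, Finset.mem_erase] at h ⊢
      exact ⟨h.2.2, fun e => h.2.1 e.symm, h.1⟩
    · rintro ⟨v, w⟩ h
      rfl
  · intro v hv
    rw [Finset.card_erase_of_mem hv]
    split_ifs with h1 h2 h2
    · simp
    · omega
    · omega
    · rw [Finset.smul_sum]
      refine Finset.sum_congr rfl fun w _ => ?_
      rw [mul_smul, Finsupp.smul_single_one]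

variable {𝔽}

theorem cycles_mono {K L : PreAbstractSimplicialComplex V} (h : K ≤ L) (m : ℕ) :
    cycles 𝔽 K m ≤ cycles 𝔽 L m :=
  inf_le_inf_right _ (chains_mono h m)

theorem boundaries_mono {K L : PreAbstractSimplicialComplex V} (h : K ≤ L) (m : ℕ) :
    boundaries 𝔽 K m ≤ boundaries 𝔽 L m :=
  Submodule.map_mono (chains_mono h (m + 1))

/-- Boundaries are cycles. -/
theorem boundaries_le_cycles (K : PreAbstractSimplicialComplex V) (m : ℕ) :
    boundaries 𝔽 K m ≤ cycles 𝔽 K m := by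
  rintro _ ⟨c, hc, rfl⟩
  refine ⟨?_, boundary_boundary 𝔽 c⟩
  rw [boundary, Finsupp.linearCombination_apply]
  refine Submodule.sum_mem _ fun s hs => Submodule.smul_mem _ _ ?_
  obtain ⟨hsK, hcard⟩ := hc hs
  rw [if_neg (by omega)]
  refine Submodule.sum_mem _ fun v hv => Finsupp.single_mem_supported _ _ ?_
  have hc' : (s.erase v).card = m + 1 := by rw [Finset.card_erase_of_mem hv]; omega
  exact ⟨(K.isRelLowerSet_faces hsK).2 (Finset.erase_subset v s)
    (Finset.card_pos.mp (by omega)), hc'⟩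

variable (𝔽)

/-- The `m`-th simplicial homology of `K`: cycles modulo boundaries. -/
noncomputable def simplicialHomology (K : PreAbstractSimplicialComplex V) (m : ℕ) :
    ModuleCat.{u} 𝔽 :=
  subquotient (cycles 𝔽 K m) (boundaries 𝔽 K m)

/-- The map on homology induced by the inclusion of a subcomplex. -/
noncomputable def homologyMap {K L : PreAbstractSimplicialComplex V} (h : K ≤ L) (m : ℕ) :
    simplicialHomology 𝔽 K m ⟶ simplicialHomology 𝔽 L m :=
  subquotientMap (cycles_mono h m) (boundaries_mono h m)

end Homology

/-! ### Filtrations -/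

/-- A finite simplicial filtration indexed by `P`, of a finite complex `K`: a monotone map `F` from
`P` to the subcomplexes of `K`, with the value `K` somewhere, such that every simplex of `K` is born
at finitely many points. -/
structure FiniteFiltration (P : Type) [PartialOrder P] (V : Type) where
  /-- the filtered complex -/
  K : PreAbstractSimplicialComplex V
  /-- the subcomplex at a given index -/
  F : P → PreAbstractSimplicialComplex V
  le_K : ∀ p, F p ≤ K
  mono : Monotone F
  exists_eq : ∃ p, F p = K
  finite_K : K.faces.Finite
  births : ∀ s ∈ K.faces, ∃ Q : Finset P, ∀ p, s ∈ (F p).faces ↔ ∃ q ∈ Q, q ≤ p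

namespace FiniteFiltration

variable {P : Type} [PartialOrder P] {V : Type}

/-- The number of simplices of the filtration. -/
noncomputable def numSimplices (Φ : FiniteFiltration P V) : ℕ := Φ.K.faces.ncard

/-- The `P`-module given by the `m`-th homology of a filtration. -/
noncomputable def homology [LinearOrder V] (Φ : FiniteFiltration P V) (𝔽 : Type u) [Field 𝔽]
    (m : ℕ) : P ⥤ ModuleCat.{u} 𝔽 where
  obj p := simplicialHomology 𝔽 (Φ.F p) m
  map f := homologyMap 𝔽 (Φ.mono (leOfHom f)) m
  map_id _ := subquotientMap_refl _ _
  map_comp _ _ := subquotientMap_trans _ _ _ _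

end FiniteFiltration

end MultiPers

/-! The idea is to make a linear number of simplices produce a generalized rank function containing
the indicator of a disjunction of `n` independent conditions. Expanding that indicator in principal
indicators `I ↦ [I ⊆ J]` takes `2 ^ n - 1` intervals `J`, and uniqueness of the diagram leaves no
shorter expansion.

Take an `(m + 1)`-ball cut by interior ridges into `n` facets placed in a row. Let `z i` be the
boundary of the `i`-th facet. Everything except the interior ridges and the facets is born at `a`.
The ridges appear on entering an upper set `C`, and the `i`-th facet appears at `b i`, where the `b
i` form an antichain above a point `c` of `C`. Below `C` the only cycle carrying facet coefficients
is, up to multiples and cycles with zero coefficients, the outer sphere `∑ i, z i`. Inside `C` every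
`z i` is a cycle.

Let `I` lie above `a`. If `I` is inside `C`, its rank is a constant `e` plus the number of `j` for
which `I` misses the points above `b j`. If `I` leaves `C`, a section must start from the outer
sphere, which survives to the colimit exactly when some such `j` exists. The rank is then `e` plus
the indicator of `∃ j`. Inclusion-exclusion turns this into coefficients `±1` on the distinct
intervals `U T` for nonempty `T`, and the intervals `V T` correct the values inside `C`. The
constant `e` comes from cycles unrelated to the facets and never has to be evaluated.

The rank formulas are `CycleSystem.genRank_of_subset` and `CycleSystem.genRank_of_not_subset`, both
resting on `genRank_subquotientFunctor`. `Arrangement.sumAbove_diagram` matches them with the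
diagram, and `PathJoin.cycleSystem` supplies the geometry. -/

namespace MultiPers

/-! ### Diagrams from finite sums of principal indicator functions -/

section Diagrams

open Classical in
/-- The sum of the values of `g` over the intervals containing `I`. -/
noncomputable def sumAbove {P : Type} [PartialOrder P] (I : Interval P) :
    (Interval P →₀ ℤ) →+ ℤ :=
  Finsupp.liftAddHom fun J => if I ≤ J then AddMonoidHom.id ℤ else 0

open Classical in
theorem sumAbove_single {P : Type} [PartialOrder P] (I J : Interval P) (c : ℤ) :
    sumAbove I (Finsupp.single J c) = if I ≤ J then c else 0 := by
  unfold sumAbove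
  rw [Finsupp.liftAddHom_apply_single]
  split_ifs <;> rfl

theorem sumAbove_eq_finsum {P : Type} [PartialOrder P] (I : Interval P) (g : Interval P →₀ ℤ) :
    sumAbove I g = ∑ᶠ (J : Interval P) (_ : I ≤ J), g J := by
  classical
  rw [finsum_eq_sum_of_support_subset (s := g.support), sumAbove, Finsupp.liftAddHom_apply,
    Finsupp.sum]
  · refine Finset.sum_congr rfl fun J _ => ?_
    by_cases h : I ≤ J <;> simp [h]
  · intro J hJ
    rw [Finset.mem_coe, Finsupp.mem_support_iff]
    exact fun h0 => hJ (by simp [h0])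

/-- A finitely supported function whose sums over the intervals containing `I` are the generalized
ranks is the generalized persistence diagram. -/
theorem isGPD_of_sumAbove {P : Type} [PartialOrder P] {𝔽 : Type u} [Field 𝔽]
    {M : P ⥤ ModuleCat.{u} 𝔽} (g : Interval P →₀ ℤ)
    (h : ∀ I, (genRank M I : ℤ) = sumAbove I g) : IsGPD M g := by
  refine fun I => ⟨?_, ?_⟩
  · exact g.support.finite_toSet.subset fun J hJ => by simpa using hJ.2
  · rw [h I, sumAbove_eq_finsum]

open Classical in
/-- Inclusion-exclusion for the indicator function of a disjunction. -/
theorem sum_neg_one_pow_card_forall {ι : Type*} [Fintype ι] (p : ι → Prop) :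
    ∑ T ∈ (Finset.univ : Finset (Finset ι)).erase ∅,
      (if ∀ j ∈ T, p j then (-1 : ℤ) ^ (T.card + 1) else 0) = if ∃ j, p j then 1 else 0 := by
  have h := Finset.sum_powerset_neg_one_pow_card (x := Finset.univ.filter p)
  -- The sets `T` that contribute form the powerset of `{j | p j}`, so their alternating sum
  -- vanishes unless that set is empty. Removing the term `1` of `T = ∅` and changing signs then
  -- gives the complementary indicator.
  have h1 : ∑ T : Finset ι, (if ∀ j ∈ T, p j then (-1 : ℤ) ^ T.card else 0) =
      if (Finset.univ.filter p) = ∅ then 1 else 0 := by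
    rw [← h, ← Finset.sum_filter]
    refine Finset.sum_congr ?_ fun _ _ => rfl
    ext T
    simp [Finset.subset_iff]
  rw [← Finset.add_sum_erase _ _ (Finset.mem_univ ∅), if_pos (by simp), Finset.card_empty,
    pow_zero] at h1
  have h2 : ∑ T ∈ (Finset.univ : Finset (Finset ι)).erase ∅,
      (if ∀ j ∈ T, p j then (-1 : ℤ) ^ (T.card + 1) else 0) =
      - ∑ T ∈ (Finset.univ : Finset (Finset ι)).erase ∅,
      (if ∀ j ∈ T, p j then (-1 : ℤ) ^ T.card else 0) := by
    rw [← Finset.sum_neg_distrib]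
    refine Finset.sum_congr rfl fun T _ => ?_
    split_ifs <;> ring
  rw [h2]
  by_cases hp : ∃ j, p j
  · have : Finset.univ.filter p ≠ ∅ := by
      obtain ⟨j, hj⟩ := hp
      exact Finset.ne_empty_of_mem (a := j) (by simp [hj])
    rw [if_neg this] at h1
    rw [if_pos hp]
    linarith
  · have : Finset.univ.filter p = ∅ := by
      simpa [Finset.filter_eq_empty_iff] using hp
    rw [if_pos this] at h1
    rw [if_neg hp]
    linarith

end Diagrams

/-! ### Arrangements of regions -/

/-- A bottom element `a`, an upper set `C` of points above `a` such that every point above `a` and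
outside `C` lies below `c ∈ C`, and an antichain of points `b i` above `c`. -/
structure Arrangement (P : Type) [PartialOrder P] (n : ℕ) where
  /-- the bottom element -/
  a : P
  /-- a base point of the upper set -/
  c : P
  /-- the upper set -/
  C : Set P
  /-- the antichain -/
  b : Fin n → P
  isUpperSet : IsUpperSet C
  a_le : ∀ p ∈ C, a ≤ p
  a_notMem : a ∉ C
  c_mem : c ∈ C
  le_c : ∀ p, a ≤ p → p ∉ C → p ≤ c
  exists_le : ∀ p ∈ C, ∃ q ∈ C, q ≤ p ∧ q ≤ c
  c_le : ∀ i, c ≤ b i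
  not_le_c : ∀ i, ¬ b i ≤ c
  eq_of_le : ∀ i j, b i ≤ b j → i = j

namespace Arrangement

variable {P : Type} [PartialOrder P] {n : ℕ} (R : Arrangement P n)

/-- The points above `a` which are not above `b j` for any `j ∈ T`. -/
def U (T : Finset (Fin n)) : Interval P where
  val := {p | R.a ≤ p ∧ ∀ j ∈ T, ¬ R.b j ≤ p}
  property := by
    have ha : R.a ∈ {p | R.a ≤ p ∧ ∀ j ∈ T, ¬ R.b j ≤ p} :=
      ⟨le_refl _, fun j _ h => R.not_le_c j (h.trans (R.a_le _ R.c_mem))⟩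
    refine ⟨⟨R.a, ha⟩, ?_, ?_⟩
    · rintro p ⟨hp, -⟩ q ⟨-, hq⟩ r hpr hrq
      exact ⟨hp.trans hpr, fun j hj h => hq j hj (h.trans hrq)⟩
    · intro p hp q hq
      exact (Relation.ReflTransGen.single ⟨ha, Or.inr hp.1⟩).tail ⟨hq, Or.inl hq.1⟩

/-- The points of `C` which are not above `b j` for any `j ∈ T`. -/
def V (T : Finset (Fin n)) : Interval P where
  val := {p | p ∈ R.C ∧ ∀ j ∈ T, ¬ R.b j ≤ p}
  property := by
    have hc : R.c ∈ {p | p ∈ R.C ∧ ∀ j ∈ T, ¬ R.b j ≤ p} :=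
      ⟨R.c_mem, fun j _ h => R.not_le_c j h⟩
    refine ⟨⟨R.c, hc⟩, ?_, ?_⟩
    · rintro p ⟨hp, -⟩ q ⟨-, hq⟩ r hpr hrq
      exact ⟨R.isUpperSet hpr hp, fun j hj h => hq j hj (h.trans hrq)⟩
    · intro p hp q hq
      -- The connecting path is `p ≥ p' ≤ c ≥ q' ≤ q`. Passing to smaller points of `C` cannot bring
      -- the path above any `b j`.
      obtain ⟨p', hp', hp1, hp2⟩ := R.exists_le p hp.1
      obtain ⟨q', hq', hq1, hq2⟩ := R.exists_le q hq.1
      refine (((Relation.ReflTransGen.single (b := p') ⟨⟨hp', fun j hj h => hp.2 j hj (h.trans hp1)⟩,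
        Or.inr hp1⟩).tail (c := R.c) ⟨hc, Or.inl hp2⟩).tail (c := q')
          ⟨⟨hq', fun j hj h => hq.2 j hj (h.trans hq1)⟩, Or.inr hq2⟩).tail ⟨hq, Or.inl hq1⟩

theorem le_U_iff (I : Interval P) (T : Finset (Fin n)) :
    I ≤ R.U T ↔ (∀ p ∈ I.1, R.a ≤ p) ∧ ∀ j ∈ T, ∀ p ∈ I.1, ¬ R.b j ≤ p :=
  ⟨fun h => ⟨fun _ hp => (h hp).1, fun j hj _ hp => (h hp).2 j hj⟩,
    fun h p hp => ⟨h.1 p hp, fun j hj => h.2 j hj p hp⟩⟩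

theorem le_V_iff (I : Interval P) (T : Finset (Fin n)) :
    I ≤ R.V T ↔ I.1 ⊆ R.C ∧ ∀ j ∈ T, ∀ p ∈ I.1, ¬ R.b j ≤ p :=
  ⟨fun h => ⟨fun _ hp => (h hp).1, fun j hj _ hp => (h hp).2 j hj⟩,
    fun h p hp => ⟨h.1 hp, fun j hj => h.2 j hj p hp⟩⟩

/-- This is where the antichain condition enters: the points `b j` recover `T` from `U T`, so the `2
^ n` intervals are distinct. -/
theorem b_mem_U_iff (T : Finset (Fin n)) (j : Fin n) : R.b j ∈ (R.U T).1 ↔ j ∉ T := by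
  refine ⟨fun h hj => h.2 j hj le_rfl, fun h => ⟨(R.a_le _ R.c_mem).trans (R.c_le j), ?_⟩⟩
  exact fun i hi hij => h (R.eq_of_le i j hij ▸ hi)

theorem U_injective : Function.Injective R.U := fun T T' h => by
  ext j
  have := R.b_mem_U_iff T j
  rw [h, R.b_mem_U_iff] at this
  tauto

theorem V_ne_U (T T' : Finset (Fin n)) : R.V T ≠ R.U T' := fun h => by
  have h1 : R.a ∈ (R.U T').1 :=
    ⟨le_refl _, fun j _ h => R.not_le_c j (h.trans (R.a_le _ R.c_mem))⟩
  rw [← h] at h1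
  exact R.a_notMem h1.1

/-- The diagram with the values `(-1) ^ (|T| + 1)` on `U T` and `-(-1) ^ (|T| + 1)` on `V T` for
nonempty `T`, plus one on the sets `V {j}` and plus `e` on `U ∅`. -/
noncomputable def diagram (e : ℤ) : Interval P →₀ ℤ :=
  (∑ T ∈ (Finset.univ : Finset (Finset (Fin n))).erase ∅,
      Finsupp.single (R.U T) ((-1 : ℤ) ^ (T.card + 1))) -
    (∑ T ∈ (Finset.univ : Finset (Finset (Fin n))).erase ∅,
      Finsupp.single (R.V T) ((-1 : ℤ) ^ (T.card + 1))) +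
    (∑ j, Finsupp.single (R.V {j}) 1) + Finsupp.single (R.U ∅) e

/-- Nothing cancels on these intervals: they are pairwise distinct, differ from `U ∅`, and differ
from every `V T'` because they contain `a`. -/
theorem diagram_U (e : ℤ) {T : Finset (Fin n)} (hT : T ≠ ∅) :
    R.diagram e (R.U T) = (-1 : ℤ) ^ (T.card + 1) := by
  classical
  simp only [diagram, Finsupp.add_apply, Finsupp.sub_apply, Finsupp.finsetSum_apply,
    Finsupp.single_apply, R.V_ne_U, R.U_injective.eq_iff, if_false, Finset.sum_const_zero,
    hT.symm, add_zero, sub_zero]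
  rw [Finset.sum_ite_eq' , if_pos (by simp [hT])]

theorem two_pow_sub_one_le_ncard_support (e : ℤ) :
    2 ^ n - 1 ≤ (Function.support (R.diagram e)).ncard := by
  classical
  have h1 : (((Finset.univ : Finset (Finset (Fin n))).erase ∅).image R.U).card = 2 ^ n - 1 := by
    rw [Finset.card_image_of_injective _ R.U_injective, Finset.card_erase_of_mem (by simp)]
    simp
  rw [← h1, ← Set.ncard_coe_finset]
  refine Set.ncard_le_ncard ?_ (R.diagram e).hasFiniteSupport
  intro J hJ
  simp only [Finset.coe_image, Set.mem_image, Finset.mem_coe, Finset.mem_erase] at hJ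
  obtain ⟨T, ⟨hT, -⟩, rfl⟩ := hJ
  rw [Function.mem_support, R.diagram_U e hT]
  exact pow_ne_zero _ (by norm_num)

open Classical in
/-- The sums of the diagram over the intervals containing `I`. -/
theorem sumAbove_diagram (e : ℤ) (I : Interval P) :
    sumAbove I (R.diagram e) =
      if ∀ p ∈ I.1, R.a ≤ p then
        e + if I.1 ⊆ R.C then
          ((Finset.univ.filter fun j => ∀ p ∈ I.1, ¬ R.b j ≤ p).card : ℤ)
        else if ∃ j, ∀ p ∈ I.1, ¬ R.b j ≤ p then 1 else 0
      else 0 := by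
  have hinc := sum_neg_one_pow_card_forall fun j => ∀ p ∈ I.1, ¬ R.b j ≤ p
  simp only [diagram, map_add, map_sub, map_sum, sumAbove_single, le_U_iff, le_V_iff]
  by_cases ha : ∀ p ∈ I.1, R.a ≤ p
  · rw [if_pos ha]
    replace ha := eq_true ha
    by_cases hC : I.1 ⊆ R.C
    -- Inside `C` the containments in `U T` and `V T` are the same condition, so the two alternating
    -- sums cancel. The singletons `V {j}` supply the count.
    · simp only [ha, hC, true_and, Finset.mem_singleton, forall_eq, Finset.notMem_empty,
        false_implies, implies_true, and_self, if_true, sub_self, zero_add, Finset.card_filter]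
      push_cast
      ring
    -- Outside `C` no `V T` contains `I`, and inclusion-exclusion evaluates the remaining sum over
    -- the `U T`.
    · simp only [ha, hC, true_and, false_and, if_false, Finset.notMem_empty, false_implies,
        implies_true, if_true, Finset.sum_const_zero]
      rw [sub_zero, add_zero, add_comm]
      congr 1
      convert hinc
  · have hC : ¬ I.1 ⊆ R.C := fun h => ha fun p hp => R.a_le p (h hp)
    simp only [ha, hC, false_and, if_false, Finset.sum_const_zero, sub_zero, add_zero]

end Arrangement

/-! ### Generalized ranks of modules of subquotients -/

section Subquotients

variable {𝔽 : Type u} [Field 𝔽] {P : Type} [PartialOrder P] {A : Type u} [AddCommGroup A]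
  [Module 𝔽 A]

/-- The `P`-module `p ↦ Z p / B p` for monotone families of submodules `Z` and `B`. -/
noncomputable def subquotientFunctor (Z B : P → Submodule 𝔽 A) (hZ : Monotone Z)
    (hB : Monotone B) : P ⥤ ModuleCat.{u} 𝔽 where
  obj p := subquotient (Z p) (B p)
  map f := subquotientMap (hZ (leOfHom f)) (hB (leOfHom f))
  map_id _ := subquotientMap_refl _ _
  map_comp _ _ := subquotientMap_trans _ _ _ _

variable {Z B : P → Submodule 𝔽 A} {hZ : Monotone Z} {hB : Monotone B}

/-- The generalized rank can be computed at any point of the interval. -/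
theorem genRank_eq (M : P ⥤ ModuleCat.{u} 𝔽) (I : Interval P) (p : I.1) :
    genRank M I = Module.finrank 𝔽 (LinearMap.range (limitToColimit M I.1 p).hom) := by
  rw [genRank, limitToColimit_eq M I _ p]

/-- The class in the colimit over `I` of an element of `Z p`. -/
noncomputable def colimitClass (hZ : Monotone Z) (hB : Monotone B) (I : Set P) (p : I) :
    Z p →ₗ[𝔽] (colimit (restrict (subquotientFunctor Z B hZ hB) I) : ModuleCat.{u} 𝔽) :=
  (colimit.ι (restrict (subquotientFunctor Z B hZ hB) I) p).hom ∘ₗ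
    ((B p).submoduleOf (Z p)).mkQ

theorem colimitClass_of_le (I : Set P) {p q : I} (h : p ≤ q) (x : A) (hx : x ∈ Z p) :
    colimitClass hZ hB I p ⟨x, hx⟩ = colimitClass hZ hB I q ⟨x, hZ h hx⟩ := by
  have := colimit.w (restrict (subquotientFunctor Z B hZ hB) I) (homOfLE h)
  unfold colimitClass
  rw [← this]
  rfl

theorem colimitClass_eq_zero (I : Set P) (p : I) (x : A) (hx : x ∈ Z p) (hxB : x ∈ B p) :
    colimitClass hZ hB I p ⟨x, hx⟩ = 0 := by
  have h : ((B p).submoduleOf (Z p)).mkQ ⟨x, hx⟩ = 0 := (Submodule.Quotient.mk_eq_zero _).2 hxB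
  exact (congrArg (colimit.ι (restrict (subquotientFunctor Z B hZ hB) I) p).hom h).trans
    (map_zero _)

/-- On an interval over which `x` is always a member of `Z`, its class does not depend on the
point. -/
theorem colimitClass_eq (I : Interval P) (x : A) (hx : ∀ p ∈ I.1, x ∈ Z p) (p q : I.1) :
    colimitClass hZ hB I.1 p ⟨x, hx p p.2⟩ = colimitClass hZ hB I.1 q ⟨x, hx q q.2⟩ := by
  obtain ⟨p, hp⟩ := p
  obtain ⟨q, hq⟩ := q
  induction I.2.connected p hp q hq with
  | refl => rfl
  | @tail b c hab hbc ih =>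
    have hb : b ∈ I.1 := by
      rcases Relation.ReflTransGen.cases_tail hab with h | ⟨_, _, h⟩
      · exact h ▸ hp
      · exact h.1
    refine (ih hb).trans ?_
    rcases hbc.2 with h | h
    · exact colimitClass_of_le I.1 (p := ⟨b, hb⟩) (q := ⟨c, hq⟩) h x _
    · exact (colimitClass_of_le I.1 (p := ⟨c, hq⟩) (q := ⟨b, hb⟩) h x _).symm

/-- The cone of constant sections with values in `Z p`. -/
noncomputable def constCone (hZ : Monotone Z) (hB : Monotone B) (I : Set P) (W : Submodule 𝔽 A)
    (hW : ∀ q ∈ I, W ≤ Z q) : Cone (restrict (subquotientFunctor Z B hZ hB) I) where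
  pt := ModuleCat.of 𝔽 W
  π :=
    { app := fun q => ModuleCat.ofHom
        (((B q).submoduleOf (Z q)).mkQ ∘ₗ Submodule.inclusion (hW q q.2))
      naturality := fun _ _ _ => rfl }

/-- A linear map vanishing on `B` induces a map from the colimit. -/
noncomputable def colimitCocone (hZ : Monotone Z) (hB : Monotone B) (I : Set P) {Y : Type u}
    [AddCommGroup Y] [Module 𝔽 Y] (Θ : A →ₗ[𝔽] Y) (hΘ : ∀ q ∈ I, B q ≤ LinearMap.ker Θ) :
    Cocone (restrict (subquotientFunctor Z B hZ hB) I) where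
  pt := ModuleCat.of 𝔽 Y
  ι :=
    { app := fun q => ModuleCat.ofHom (((B q).submoduleOf (Z q)).liftQ
        (Θ ∘ₗ (Z q).subtype) fun _ hx => hΘ q q.2 hx)
      naturality := fun q r h => ModuleCat.hom_ext (LinearMap.ext fun x => by
        obtain ⟨x, rfl⟩ := Submodule.mkQ_surjective _ x
        rfl) }

/-- If `Z p` is the smallest of the cycle spaces over `I`, and the map `Θ`, which vanishes on all
boundaries over `I`, detects which elements of `Z p` become zero in the colimit over `I`, then the
generalized rank over `I` is the dimension of the image of `Z p` under `Θ`. -/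
theorem genRank_subquotientFunctor (I : Interval P) (p : I.1) (hp : ∀ q ∈ I.1, Z p ≤ Z q)
    {Y : Type u} [AddCommGroup Y] [Module 𝔽 Y] (Θ : A →ₗ[𝔽] Y)
    (hΘ : ∀ q ∈ I.1, B q ≤ LinearMap.ker Θ)
    (hker : ∀ x (hx : x ∈ Z p), Θ x = 0 → colimitClass hZ hB I.1 p ⟨x, hx⟩ = 0) :
    genRank (subquotientFunctor Z B hZ hB) I = Module.finrank 𝔽 ((Z p).map Θ) := by
  rw [genRank_eq _ I p]
  set M := restrict (subquotientFunctor Z B hZ hB) I.1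
  -- Every element of `Z p` extends to a constant section, since `Z p` lies in all `Z q`. Hence the
  -- limit loses nothing of the image of `Z p` in the colimit.
  have h1 : LinearMap.range (limitToColimit (subquotientFunctor Z B hZ hB) I.1 p).hom =
      LinearMap.range (colimitClass hZ hB I.1 p) := by
    apply le_antisymm
    · rintro _ ⟨y, rfl⟩
      obtain ⟨x, hx⟩ := Submodule.mkQ_surjective ((B p).submoduleOf (Z p)) ((limit.π M p).hom y)
      exact ⟨x, congrArg (colimit.ι M p).hom hx⟩
    · rintro _ ⟨x, rfl⟩
      refine ⟨(limit.lift M (constCone hZ hB I.1 (Z p) hp)).hom x, ?_⟩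
      have h := limit.lift_π (constCone hZ hB I.1 (Z p) hp) p
      have h' := congrArg (fun f => f.hom x) h
      exact congrArg (colimit.ι M p).hom h'
  -- One inclusion is the hypothesis `hker`. For the other, `Θ` factors through the colimit because
  -- it kills all boundaries over `I`.
  have h2 : (LinearMap.ker (colimitClass hZ hB I.1 p)) = LinearMap.ker (Θ ∘ₗ (Z p).subtype) := by
    ext x
    refine ⟨fun hx => ?_, fun hx => hker x x.2 hx⟩
    have h := colimit.ι_desc (colimitCocone hZ hB I.1 Θ hΘ) p
    have h' := congrArg (fun f => f.hom (((B p).submoduleOf (Z p)).mkQ x)) h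
    refine Eq.trans h'.symm ?_
    exact (congrArg (colimit.desc M (colimitCocone hZ hB I.1 Θ hΘ)).hom hx).trans (map_zero _)
  have h3 : (Z p).map Θ = LinearMap.range (Θ ∘ₗ (Z p).subtype) := by
    rw [LinearMap.range_comp, Submodule.range_subtype]
  rw [h1, h3]
  exact LinearEquiv.finrank_eq ((LinearMap.quotKerEquivRange _).symm ≪≫ₗ
    Submodule.quotEquivOfEq _ _ h2 ≪≫ₗ LinearMap.quotKerEquivRange _)

end Subquotients

/-! ### Generalized ranks over an arrangement -/

/-- The dimension of a product of subspaces. -/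
theorem finrank_submodule_prod {𝔽 A Y : Type*} [Field 𝔽] [AddCommGroup A] [Module 𝔽 A]
    [AddCommGroup Y] [Module 𝔽 Y] (p : Submodule 𝔽 A) (q : Submodule 𝔽 Y) [Module.Finite 𝔽 p]
    [Module.Finite 𝔽 q] :
    Module.finrank 𝔽 (p.prod q) = Module.finrank 𝔽 p + Module.finrank 𝔽 q := by
  rw [← Module.finrank_prod]
  exact LinearEquiv.finrank_eq
    { toFun := fun x => (⟨x.1.1, x.2.1⟩, ⟨x.1.2, x.2.2⟩)
      map_add' := fun _ _ => rfl
      map_smul' := fun _ _ => rfl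
      invFun := fun x => ⟨(x.1.1, x.2.1), x.1.2, x.2.2⟩
      left_inv := fun _ => rfl
      right_inv := fun _ => rfl }

section CycleSystem

variable {𝔽 : Type u} [Field 𝔽] {P : Type} [PartialOrder P] {A : Type u} [AddCommGroup A]
  [Module 𝔽 A] {n : ℕ}

/-- Families of cycles `Z` and boundaries `B` adapted to an arrangement. There are no cycles
outside the region above `a`. In `C` there are cycles `z i`, whose coefficients are read off by
`φ`, and `z i` bounds at the points above `b i`. In the rest of the region above `a` the cycles are
those whose coefficients agree with each other, among them the sum of the `z i`. -/
structure CycleSystem (R : Arrangement P n) (Z B : P → Submodule 𝔽 A) (ZA ZC : Submodule 𝔽 A)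
    (z : Fin n → A) (φ : A →ₗ[𝔽] (Fin n → 𝔽)) : Prop where
  eq_bot : ∀ p, ¬ R.a ≤ p → Z p = ⊥
  eq_lower : ∀ p, R.a ≤ p → p ∉ R.C → Z p = ZA
  eq_upper : ∀ p ∈ R.C, Z p = ZC
  boundaries_eq : ∀ p, B p = Submodule.span 𝔽 (z '' {i | R.b i ≤ p})
  le : ZA ≤ ZC
  z_mem : ∀ i, z i ∈ ZC
  φ_z : ∀ i, φ (z i) = Pi.single i 1
  sum_mem : ∑ i, z i ∈ ZA
  φ_const : ∀ x ∈ ZA, ∃ t : 𝔽, φ x = fun _ => t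
  mem_of_φ : ∀ x ∈ ZC, φ x = 0 → x ∈ ZA

/-- The linear map which removes the cycles `z i` from a chain and records the coefficients of
those with `i ∈ T`. -/
noncomputable def detect (z : Fin n → A) (φ : A →ₗ[𝔽] (Fin n → 𝔽)) (T : Set (Fin n)) :
    A →ₗ[𝔽] A × (T → 𝔽) :=
  (LinearMap.id - ∑ i, (LinearMap.proj i ∘ₗ φ).smulRight (z i)).prod
    (LinearMap.pi fun j => LinearMap.proj j.1 ∘ₗ φ)

theorem detect_apply (z : Fin n → A) (φ : A →ₗ[𝔽] (Fin n → 𝔽)) (T : Set (Fin n)) (x : A) :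
    detect z φ T x = (x - ∑ i, φ x i • z i, fun j : T => φ x j) := by
  ext
  · simp [detect]
  · simp [detect]

/-- A class is zero if it is a combination of zero classes. -/
theorem colimitClass_sum_eq_zero {Z B : P → Submodule 𝔽 A} {hZ : Monotone Z} {hB : Monotone B}
    {I : Set P} {p : I} {ι : Type*} [Fintype ι] {x : A} (hx : x ∈ Z p) (y : ι → A) (c : ι → 𝔽)
    (hxy : x = ∑ i, c i • y i) (hy : ∀ i, y i ∈ Z p)
    (h : ∀ i, c i ≠ 0 → colimitClass hZ hB I p ⟨y i, hy i⟩ = 0) :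
    colimitClass hZ hB I p ⟨x, hx⟩ = 0 := by
  have hx' : (⟨x, hx⟩ : Z p) = ∑ i, c i • (⟨y i, hy i⟩ : Z p) := by
    ext
    simp [hxy]
  rw [hx', map_sum]
  refine Finset.sum_eq_zero fun i _ => ?_
  rw [map_smul]
  by_cases hi : c i = 0
  · rw [hi, zero_smul]
  · rw [h i hi, smul_zero]

namespace CycleSystem

variable {R : Arrangement P n} {Z B : P → Submodule 𝔽 A} {ZA ZC : Submodule 𝔽 A} {z : Fin n → A}
  {φ : A →ₗ[𝔽] (Fin n → 𝔽)}

theorem φ_sum (hS : CycleSystem R Z B ZA ZC z φ) (c : Fin n → 𝔽) : φ (∑ i, c i • z i) = c := by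
  simp only [map_sum, map_smul, hS.φ_z]
  ext j
  simp [Finset.sum_apply, Pi.single_apply]

theorem detect_z (hS : CycleSystem R Z B ZA ZC z φ) {T : Set (Fin n)} {i : Fin n} (hi : i ∉ T) :
    detect z φ T (z i) = 0 := by
  rw [detect_apply, hS.φ_z, Prod.mk_eq_zero]
  constructor
  · simp [Pi.single_apply]
  · ext j
    exact Pi.single_eq_of_ne (fun h : j.1 = i => hi (h ▸ j.2)) _

theorem boundaries_le_ker (hS : CycleSystem R Z B ZA ZC z φ) {T : Set (Fin n)} {p : P}
    (hT : ∀ i ∈ T, ¬ R.b i ≤ p) : B p ≤ LinearMap.ker (detect z φ T) := by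
  rw [hS.boundaries_eq, Submodule.span_le]
  rintro _ ⟨i, hi, rfl⟩
  exact hS.detect_z fun h => hT i h hi

theorem z_mem_boundaries (hS : CycleSystem R Z B ZA ZC z φ) {i : Fin n} {p : P}
    (h : R.b i ≤ p) : z i ∈ B p := by
  rw [hS.boundaries_eq]
  exact Submodule.subset_span ⟨i, h, rfl⟩

theorem eq_sum_of_detect (z : Fin n → A) (φ : A →ₗ[𝔽] (Fin n → 𝔽)) {T : Set (Fin n)} {x : A}
    (h : detect z φ T x = 0) : x = ∑ i, φ x i • z i ∧ ∀ i ∈ T, φ x i = 0 := by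
  rw [detect_apply, Prod.mk_eq_zero] at h
  exact ⟨sub_eq_zero.1 h.1, fun i hi => congrFun h.2 ⟨i, hi⟩⟩

theorem sub_mem (hS : CycleSystem R Z B ZA ZC z φ) {x : A} (hx : x ∈ ZC) :
    x - ∑ i, φ x i • z i ∈ ZC ⊓ LinearMap.ker φ := by
  refine ⟨ZC.sub_mem hx (ZC.sum_mem fun i _ => ZC.smul_mem _ (hS.z_mem i)), ?_⟩
  exact LinearMap.mem_ker.2 (by rw [map_sub, hS.φ_sum, sub_self])

theorem detect_add_sum (hS : CycleSystem R Z B ZA ZC z φ) (T : Set (Fin n)) {u : A}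
    (hu : φ u = 0) (c : Fin n → 𝔽) :
    detect z φ T (u + ∑ i, c i • z i) = (u, fun j : T => c j) := by
  rw [detect_apply, map_add, hS.φ_sum, hu, zero_add, add_sub_cancel_right]

/-- All `z i` lie in `ZC`, so the recorded coefficients are arbitrary and independent of the part
with zero coefficients. This is the source of the count in the rank inside `C`. -/
theorem map_upper (hS : CycleSystem R Z B ZA ZC z φ) (T : Set (Fin n)) :
    ZC.map (detect z φ T) = (ZC ⊓ LinearMap.ker φ).prod ⊤ := by
  classical
  apply le_antisymm
  · rintro _ ⟨x, hx, rfl⟩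
    rw [detect_apply]
    exact ⟨hS.sub_mem hx, trivial⟩
  · rintro ⟨u, c⟩ ⟨hu, -⟩
    refine ⟨u + ∑ i, (if h : i ∈ T then c ⟨i, h⟩ else 0) • z i, ZC.add_mem hu.1
      (ZC.sum_mem fun i _ => ZC.smul_mem _ (hS.z_mem i)), ?_⟩
    rw [hS.detect_add_sum T hu.2]
    simp

/-- In `ZA` all coefficients of a cycle agree, so the recorded ones form only a diagonal line. It is
zero exactly when `T` is empty, which produces the indicator of a disjunction. -/
theorem map_lower (hS : CycleSystem R Z B ZA ZC z φ) (T : Set (Fin n)) :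
    ZA.map (detect z φ T) =
      (ZC ⊓ LinearMap.ker φ).prod (Submodule.span 𝔽 {fun _ : T => (1 : 𝔽)}) := by
  apply le_antisymm
  · rintro _ ⟨x, hx, rfl⟩
    rw [detect_apply]
    refine ⟨hS.sub_mem (hS.le hx), ?_⟩
    obtain ⟨t, ht⟩ := hS.φ_const x hx
    refine Submodule.mem_span_singleton.2 ⟨t, ?_⟩
    ext j
    simp [ht]
  · rintro ⟨u, c⟩ ⟨hu, hc⟩
    obtain ⟨t, rfl⟩ := Submodule.mem_span_singleton.1 hc
    refine ⟨u + ∑ i, t • z i, ZA.add_mem (hS.mem_of_φ u hu.1 hu.2) ?_, ?_⟩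
    · rw [← Finset.smul_sum]
      exact ZA.smul_mem _ hS.sum_mem
    · rw [hS.detect_add_sum T hu.2 fun _ => t]
      ext <;> simp

theorem genRank_of_not_le (hS : CycleSystem R Z B ZA ZC z φ) (hZ : Monotone Z) (hB : Monotone B)
    (I : Interval P) (hI : ¬ ∀ p ∈ I.1, R.a ≤ p) :
    genRank (subquotientFunctor Z B hZ hB) I = 0 := by
  push Not at hI
  obtain ⟨p, hp, hap⟩ := hI
  have hbot := hS.eq_bot p hap
  rw [genRank_subquotientFunctor I ⟨p, hp⟩ (fun q _ => hbot.trans_le bot_le)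
    (0 : A →ₗ[𝔽] A) (fun q _ => by simp)]
  · rw [hbot, Submodule.map_bot, finrank_bot]
  · intro x hx _
    have hx0 : x = 0 := by simpa [hbot] using hx
    subst hx0
    exact map_zero _

theorem genRank_of_subset (hS : CycleSystem R Z B ZA ZC z φ) [Module.Finite 𝔽 ZC]
    (hZ : Monotone Z) (hB : Monotone B) (I : Interval P) (hI : I.1 ⊆ R.C) :
    genRank (subquotientFunctor Z B hZ hB) I =
      Module.finrank 𝔽 (ZC ⊓ LinearMap.ker φ : Submodule 𝔽 A) +
        {j | ∀ p ∈ I.1, ¬ R.b j ≤ p}.ncard := by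
  classical
  have : Module.Finite 𝔽 (ZC ⊓ LinearMap.ker φ : Submodule 𝔽 A) :=
    Submodule.finiteDimensional_of_le inf_le_left
  obtain ⟨p, hp⟩ := I.2.nonempty
  have hz : ∀ i, ∀ q ∈ I.1, z i ∈ Z q := fun i q hq => by
    rw [hS.eq_upper q (hI hq)]
    exact hS.z_mem i
  rw [genRank_subquotientFunctor I ⟨p, hp⟩
    (fun q hq => by rw [hS.eq_upper p (hI hp), hS.eq_upper q (hI hq)])
    (detect z φ {j | ∀ p ∈ I.1, ¬ R.b j ≤ p})
    (fun q hq => hS.boundaries_le_ker fun i hi => hi q hq)]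
  · rw [hS.eq_upper p (hI hp), hS.map_upper, finrank_submodule_prod, finrank_top,
      Module.finrank_fintype_fun_eq_card, ← Nat.card_eq_fintype_card, Nat.card_coe_set_eq]
  · intro x hx hx0
    obtain ⟨h1, h2⟩ := eq_sum_of_detect z φ hx0
    refine colimitClass_sum_eq_zero hx z (φ x) h1 (fun i => hz i p hp) fun i hi => ?_
    -- A nonzero coefficient forces `i` outside the detected set, so `I` contains a point above `b
    -- i`. The class of `z i` can be carried there, where `z i` bounds.
    have hi' := mt (h2 i) hi
    simp only [Set.mem_ofPred_eq, not_forall, not_not] at hi'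
    obtain ⟨q, hq, hbq⟩ := hi'
    rw [colimitClass_eq I (z i) (hz i) ⟨p, hp⟩ ⟨q, hq⟩]
    exact colimitClass_eq_zero _ _ _ _ (hS.z_mem_boundaries hbq)

open Classical in
theorem finrank_span_one (T : Set (Fin n)) :
    Module.finrank 𝔽 (Submodule.span 𝔽 {fun _ : T => (1 : 𝔽)}) = if ∃ j, j ∈ T then 1 else 0 := by
  split_ifs with h
  · obtain ⟨j, hj⟩ := h
    exact finrank_span_singleton fun h0 => one_ne_zero (congrFun h0 ⟨j, hj⟩)
  · have : (fun _ : T => (1 : 𝔽)) = 0 := by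
      ext j
      exact absurd ⟨j.1, j.2⟩ h
    rw [this, Submodule.span_zero_singleton, finrank_bot]

open Classical in
theorem genRank_of_not_subset (hS : CycleSystem R Z B ZA ZC z φ) [Module.Finite 𝔽 ZC]
    (hZ : Monotone Z) (hB : Monotone B) (I : Interval P) (ha : ∀ p ∈ I.1, R.a ≤ p)
    (hI : ¬ I.1 ⊆ R.C) :
    genRank (subquotientFunctor Z B hZ hB) I =
      Module.finrank 𝔽 (ZC ⊓ LinearMap.ker φ : Submodule 𝔽 A) +
        if ∃ j, ∀ p ∈ I.1, ¬ R.b j ≤ p then 1 else 0 := by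
  have : Module.Finite 𝔽 (ZC ⊓ LinearMap.ker φ : Submodule 𝔽 A) :=
    Submodule.finiteDimensional_of_le inf_le_left
  obtain ⟨p, hp, hpC⟩ := Set.not_subset.1 hI
  have hpZ := hS.eq_lower p (ha p hp) hpC
  rw [genRank_subquotientFunctor I ⟨p, hp⟩ (fun q hq => ?_)
    (detect z φ {j | ∀ p ∈ I.1, ¬ R.b j ≤ p})
    (fun q hq => hS.boundaries_le_ker fun i hi => hi q hq)]
  · rw [hpZ, hS.map_lower, finrank_submodule_prod, finrank_span_one]
    rfl
  · intro x hx hx0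
    obtain ⟨h1, h2⟩ := eq_sum_of_detect z φ hx0
    have hq : ∀ i, φ x i ≠ 0 → ∃ q ∈ I.1, R.b i ≤ q := fun i hi => by
      simpa only [Set.mem_ofPred_eq, not_forall, not_not, exists_prop] using mt (h2 i) hi
    by_cases hφ : ∃ i, φ x i ≠ 0
    · obtain ⟨i, hi⟩ := hφ
      obtain ⟨q, hqI, hbq⟩ := hq i hi
      -- At `p` the individual `z i` need not be cycles, so the sum cannot be split there. Convexity
      -- puts `c` in `I`, since `p ≤ c ≤ b i ≤ q`. At `c` the sum splits, and each summand with
      -- nonzero coefficient is carried to a point where it bounds.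
      have hpc : p ≤ R.c := R.le_c p (ha p hp) hpC
      have hc : R.c ∈ I.1 := I.2.convex p hp q hqI _ hpc ((R.c_le i).trans hbq)
      have hz : ∀ i, z i ∈ Z R.c := fun i => by
        rw [hS.eq_upper _ R.c_mem]
        exact hS.z_mem i
      rw [colimitClass_of_le I.1 (p := ⟨p, hp⟩) (q := ⟨R.c, hc⟩) hpc]
      refine colimitClass_sum_eq_zero _ z (φ x) h1 hz fun j hj => ?_
      obtain ⟨r, hrI, hbr⟩ := hq j hj
      rw [colimitClass_of_le I.1 (p := ⟨R.c, hc⟩) (q := ⟨r, hrI⟩) ((R.c_le j).trans hbr)]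
      exact colimitClass_eq_zero _ _ _ _ (hS.z_mem_boundaries hbr)
    · push Not at hφ
      have hx0 : x = 0 := h1.trans (Finset.sum_eq_zero fun i _ => by rw [hφ, zero_smul])
      subst hx0
      exact map_zero _
  · rw [hpZ]
    by_cases hqC : q ∈ R.C
    · exact (hS.eq_upper q hqC).symm ▸ hS.le
    · exact (hS.eq_lower q (ha q hq) hqC).ge

/-- The diagram of an arrangement is the generalized persistence diagram of the homology of a
cycle system. -/
theorem isGPD (hS : CycleSystem R Z B ZA ZC z φ) [Module.Finite 𝔽 ZC] (hZ : Monotone Z)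
    (hB : Monotone B) :
    IsGPD (subquotientFunctor Z B hZ hB)
      (R.diagram (Module.finrank 𝔽 (ZC ⊓ LinearMap.ker φ : Submodule 𝔽 A))) := by
  classical
  refine isGPD_of_sumAbove _ fun I => ?_
  rw [R.sumAbove_diagram]
  split_ifs with ha hC hj
  · rw [hS.genRank_of_subset hZ hB I hC, Nat.cast_add, ← Set.ncard_coe_finset]
    simp
  · rw [hS.genRank_of_not_subset hZ hB I ha hC, if_pos hj]
    simp
  · rw [hS.genRank_of_not_subset hZ hB I ha hC, if_neg hj]
    simp
  · rw [hS.genRank_of_not_le hZ hB I ha, Nat.cast_zero]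

end CycleSystem

end CycleSystem

/-! ### A triangulated ball

The join of the path with the vertices `0, …, n` and an `(m - 1)`-simplex. -/

namespace PathJoin

variable (n m : ℕ)

/-- The join of the vertex `i` with the `(m - 1)`-simplex. -/
def ridge (i : ℕ) : Finset ℕ := insert i (Finset.Ico (n + 1) (n + 1 + m))

/-- The join of the edge from `i` to `i + 1` with the `(m - 1)`-simplex. -/
def facet (i : ℕ) : Finset ℕ := insert i (ridge n m (i + 1))

variable {n m}

theorem mem_ridge {i v : ℕ} : v ∈ ridge n m i ↔ v = i ∨ (n + 1 ≤ v ∧ v < n + 1 + m) := by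
  simp [ridge]

theorem mem_facet {i v : ℕ} :
    v ∈ facet n m i ↔ v = i ∨ v = i + 1 ∨ (n + 1 ≤ v ∧ v < n + 1 + m) := by
  simp [facet, mem_ridge]

theorem card_ridge {i : ℕ} (hi : i ≤ n) : (ridge n m i).card = m + 1 := by
  rw [ridge, Finset.card_insert_of_notMem (by simp; omega)]
  simp

theorem card_facet {i : ℕ} (hi : i < n) : (facet n m i).card = m + 2 := by
  rw [facet, Finset.card_insert_of_notMem (by rw [mem_ridge]; omega), card_ridge hi]

theorem ridge_inj {i j : ℕ} (hi : i ≤ n) (h : ridge n m i = ridge n m j) : i = j := by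
  have : i ∈ ridge n m j := h ▸ mem_ridge.2 (Or.inl rfl)
  rw [mem_ridge] at this
  omega

theorem facet_inj {i j : ℕ} (hi : i < n) (h : facet n m i = facet n m j) :
    i = j := by
  have h1 : i ∈ facet n m j := h ▸ mem_facet.2 (Or.inl rfl)
  have h2 : j ∈ facet n m i := h ▸ mem_facet.2 (Or.inl rfl)
  rw [mem_facet] at h1 h2
  omega

theorem ridge_ne_facet {i j : ℕ} (hi : i ≤ n) (hj : j < n) : ridge n m i ≠ facet n m j :=
  fun h => by
    have := congrArg Finset.card h
    rw [card_ridge hi, card_facet hj] at this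
    omega

theorem erase_facet_ne_ridge {i k v : ℕ} (hv : v ∈ Finset.Ico (n + 1) (n + 1 + m)) :
    (facet n m i).erase v ≠ ridge n m k := fun h => by
  have h1 : v ∈ ridge n m k := mem_ridge.2 (Or.inr (Finset.mem_Ico.1 hv))
  rw [← h] at h1
  exact Finset.notMem_erase _ _ h1

theorem eq_facet {i : ℕ} {s : Finset ℕ} (hi : i < n) (h : s ⊆ facet n m i) (hs : m + 2 ≤ s.card) :
    s = facet n m i :=
  Finset.eq_of_subset_of_card_le h (by rw [card_facet hi]; exact hs)

variable (n m)

/-- The join of a path and a simplex. -/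
def complex : PreAbstractSimplicialComplex ℕ where
  faces := {s | s.Nonempty ∧ ∃ i < n, s ⊆ facet n m i}
  isRelLowerSet_faces := by
    rintro s ⟨hs, i, hi, hsi⟩
    exact ⟨hs, fun t hts ht => ⟨ht, i, hi, hts.trans hsi⟩⟩

theorem faces_subset :
    (complex n m).faces ⊆ ((Finset.range n).biUnion fun i => (facet n m i).powerset) := by
  rintro s ⟨-, i, hi, hs⟩
  simp only [Finset.coe_biUnion, Set.mem_iUnion, Finset.mem_coe, Finset.mem_range,
    Finset.mem_powerset]
  exact ⟨i, hi, hs⟩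

theorem finite_faces : (complex n m).faces.Finite :=
  (Finset.finite_toSet _).subset (faces_subset n m)

theorem ncard_faces_le : (complex n m).faces.ncard ≤ n * 2 ^ (m + 2) := by
  refine (Set.ncard_le_ncard (faces_subset n m) (Finset.finite_toSet _)).trans ?_
  rw [Set.ncard_coe_finset]
  refine Finset.card_biUnion_le.trans ?_
  rw [Finset.sum_congr rfl (g := fun _ => 2 ^ (m + 2))]
  · simp
  · intro i hi
    rw [Finset.card_powerset, card_facet (Finset.mem_range.1 hi)]

theorem facet_mem {i : ℕ} (hi : i < n) : facet n m i ∈ (complex n m).faces :=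
  ⟨⟨i, mem_facet.2 (Or.inl rfl)⟩, i, hi, subset_rfl⟩

theorem le_ncard_faces : n ≤ (complex n m).faces.ncard := by
  have h : ((Finset.range n).image (facet n m)).card = n := by
    rw [Finset.card_image_of_injOn, Finset.card_range]
    intro i hi j _ h
    exact facet_inj (Finset.mem_range.1 hi) h
  refine h.ge.trans ?_
  rw [← Set.ncard_coe_finset]
  refine Set.ncard_le_ncard ?_ (finite_faces n m)
  rintro s hs
  obtain ⟨i, hi, rfl⟩ := Finset.mem_image.1 hs
  exact facet_mem n m (Finset.mem_range.1 hi)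

/-! ### Cycles of the ball -/

variable (𝔽 : Type u) [Field 𝔽]

/-- The boundary of a facet. -/
noncomputable def sphere (i : ℕ) : Finset ℕ →₀ 𝔽 :=
  boundary 𝔽 (Finsupp.single (facet n m i) 1)

variable {n m}

/-- The path vertices precede those of the simplex, so deleting `i` from the facet has sign `+1` and
deleting `i + 1` has sign `-1`. Deleting a simplex vertex never leaves a ridge. -/
theorem sphere_apply_ridge {i k : ℕ} (hi : i < n) (hk : k ≤ n) :
    sphere n m 𝔽 i (ridge n m k) = (if k = i + 1 then 1 else 0) - if k = i then 1 else 0 := by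
  have hmem : i ∉ ridge n m (i + 1) := by rw [mem_ridge]; omega
  have hmem' : i + 1 ∉ Finset.Ico (n + 1) (n + 1 + m) := by simp; omega
  have hf1 : (facet n m i).filter (· < i) = ∅ := by
    ext v
    simp only [Finset.mem_filter, mem_facet, Finset.notMem_empty, iff_false]
    omega
  have hf2 : (facet n m i).filter (· < i + 1) = {i} := by
    ext v
    simp only [Finset.mem_filter, mem_facet, Finset.mem_singleton]
    omega
  have he1 : (facet n m i).erase i = ridge n m (i + 1) := Finset.erase_insert hmem
  have he2 : (facet n m i).erase (i + 1) = ridge n m i := by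
    ext v
    simp only [Finset.mem_erase, mem_facet, mem_ridge]
    omega
  rw [sphere, boundary, Finsupp.linearCombination_single, one_smul, card_facet hi,
    if_neg (by omega)]
  conv_lhs => enter [1, 1]; rw [facet]
  rw [Finset.sum_insert hmem, ridge.eq_1 n m (i + 1), Finset.sum_insert hmem', he1, he2, hf1, hf2, Finsupp.add_apply,
    Finsupp.add_apply, Finsupp.finsetSum_apply, Finset.sum_eq_zero, add_zero]
  · have h1 : ridge n m (i + 1) = ridge n m k ↔ k = i + 1 :=
      ⟨fun h => (ridge_inj hk h.symm), fun h => h ▸ rfl⟩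
    have h2 : ridge n m i = ridge n m k ↔ k = i :=
      ⟨fun h => (ridge_inj hk h.symm), fun h => h ▸ rfl⟩
    simp only [Finsupp.single_apply, h1, h2, Finset.card_empty, Finset.card_singleton, pow_zero,
      pow_one]
    split_ifs <;> simp
  · intro v hv
    exact Finsupp.single_eq_of_ne (erase_facet_ne_ridge hv).symm

variable (n m)

/-- The coefficients of an `m`-cycle with respect to the boundaries of the facets. -/
noncomputable def coefficients : (Finset ℕ →₀ 𝔽) →ₗ[𝔽] (Fin n → 𝔽) :=
  LinearMap.pi fun j => ∑ k ∈ Finset.Ico (j.1 + 1) (n + 1), Finsupp.lapply (ridge n m k)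

variable {n m}

theorem coefficients_apply (x : Finset ℕ →₀ 𝔽) (j : Fin n) :
    coefficients n m 𝔽 x j = ∑ k ∈ Finset.Ico (j.1 + 1) (n + 1), x (ridge n m k) := by
  simp [coefficients]

/-- On ridges the `i`-th sphere is `+1` at `i + 1` and `-1` at `i`. The tail sum from `j + 1` sees
both entries if `j < i`, neither if `j > i`, and only the positive one if `j = i`. -/
theorem coefficients_sphere (i : Fin n) :
    coefficients n m 𝔽 (sphere n m 𝔽 i) = Pi.single i 1 := by
  ext j
  rw [coefficients_apply, Finset.sum_congr rfl fun k hk => sphere_apply_ridge 𝔽 i.2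
    (Nat.lt_succ_iff.1 (Finset.mem_Ico.1 hk).2), Finset.sum_sub_distrib, Finset.sum_ite_eq',
    Finset.sum_ite_eq', Pi.single_apply]
  simp only [Finset.mem_Ico, Fin.ext_iff]
  have := i.2
  by_cases h1 : j.1 = i.1
  · rw [if_pos (by omega), if_neg (by omega), if_pos h1, sub_zero]
  · rw [if_neg h1]
    by_cases h2 : j.1 < i.1
    · rw [if_pos (by omega), if_pos (by omega), sub_self]
    · rw [if_neg (by omega), if_neg (by omega), sub_self]

variable (n m)

/-- The `m`-cycles whose coefficients at the interior ridges are zero. -/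
noncomputable def outerCycles : Submodule 𝔽 (Finset ℕ →₀ 𝔽) :=
  Finsupp.supported 𝔽 𝔽 {s | (s ∈ (complex n m).faces ∧ s.card = m + 1) ∧
    ∀ i, 0 < i → i < n → s ≠ ridge n m i} ⊓ LinearMap.ker (boundary 𝔽)

theorem outerCycles_le : outerCycles n m 𝔽 ≤ cycles 𝔽 (complex n m) m :=
  inf_le_inf_right _ (Finsupp.supported_mono fun _ hs => hs.1)

variable {n m}

theorem mem_outerCycles {x : Finset ℕ →₀ 𝔽} (hx : x ∈ cycles 𝔽 (complex n m) m)
    (h : ∀ i, 0 < i → i < n → x (ridge n m i) = 0) : x ∈ outerCycles n m 𝔽 :=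
  ⟨fun _ hs => ⟨hx.1 hs, fun i hi hin hsi => Finsupp.mem_support_iff.1 hs (hsi ▸ h i hi hin)⟩,
    hx.2⟩

theorem outerCycles_apply_ridge {x : Finset ℕ →₀ 𝔽} (hx : x ∈ outerCycles n m 𝔽) {i : ℕ}
    (hi : 0 < i) (hin : i < n) : x (ridge n m i) = 0 := by
  by_contra h
  exact (hx.1 (Finsupp.mem_support_iff.2 h)).2 i hi hin rfl

theorem sphere_mem_cycles {i : ℕ} (hi : i < n) : sphere n m 𝔽 i ∈ cycles 𝔽 (complex n m) m :=
  boundaries_le_cycles _ _ (Submodule.mem_map_of_mem (Finsupp.single_mem_supported 𝔽 _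
    ⟨facet_mem n m hi, card_facet hi⟩))

/-- An interior ridge `k` lies in the two facets `k - 1` and `k`, which induce opposite signs on it.
-/
theorem sum_sphere_mem : ∑ i : Fin n, sphere n m 𝔽 i ∈ outerCycles n m 𝔽 := by
  refine mem_outerCycles 𝔽 (Submodule.sum_mem _ fun i _ => sphere_mem_cycles 𝔽 i.2)
    fun k hk hkn => ?_
  rw [Finsupp.finsetSum_apply, Finset.sum_congr rfl fun i _ => sphere_apply_ridge 𝔽 i.2 hkn.le,
    Finset.sum_sub_distrib, Finset.sum_eq_single (⟨k - 1, by omega⟩ : Fin n),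
    Finset.sum_eq_single (⟨k, hkn⟩ : Fin n), if_pos (by simp; omega), if_pos rfl, sub_self]
  all_goals simp [Fin.ext_iff]
  all_goals omega

/-- Interior ridges do not contribute, so every tail sum reduces to its last term, the value at the
end ridge `n`. -/
theorem coefficients_outerCycles {x : Finset ℕ →₀ 𝔽} (hx : x ∈ outerCycles n m 𝔽) :
    coefficients n m 𝔽 x = fun _ => x (ridge n m n) := by
  ext j
  have := j.2
  rw [coefficients_apply, Finset.sum_eq_single n]
  · intro k hk hkn
    rw [Finset.mem_Ico] at hk
    exact outerCycles_apply_ridge 𝔽 hx (by omega) (by omega)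
  · simp only [Finset.mem_Ico]
    omega

theorem mem_outerCycles_of_coefficients {x : Finset ℕ →₀ 𝔽} (hx : x ∈ cycles 𝔽 (complex n m) m)
    (h : coefficients n m 𝔽 x = 0) : x ∈ outerCycles n m 𝔽 := by
  refine mem_outerCycles 𝔽 hx fun k hk hkn => ?_
  have h1 := congrFun h ⟨k - 1, by omega⟩
  have h2 := congrFun h ⟨k, hkn⟩
  rw [coefficients_apply] at h1 h2
  -- Consecutive tail sums differ by the value at ridge `k`.
  rw [show k - 1 + 1 = k by omega, Finset.sum_eq_sum_Ico_succ_bot (by omega), h2] at h1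
  simpa using h1

end PathJoin

theorem finite_chains (𝔽 : Type u) [Field 𝔽] {V : Type} {K : PreAbstractSimplicialComplex V}
    (hK : K.faces.Finite) (m : ℕ) : Module.Finite 𝔽 (chains 𝔽 K m) := by
  have : Finite {s | s ∈ K.faces ∧ s.card = m + 1} := hK.subset fun _ hs => hs.1
  exact Module.Finite.equiv (Finsupp.supportedEquivFinsupp _).symm

namespace PathJoin

/-! ### The filtration of the ball -/

section Filtration

variable {P : Type} [PartialOrder P] {n : ℕ} (m : ℕ) (R : Arrangement P n)

/-- The subcomplex at `p`: the boundary of the ball is born at `a`, the interior ridges are born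
when entering `C`, and the facets are born at the points `b i`. -/
def stage (p : P) : PreAbstractSimplicialComplex ℕ where
  faces := {s | s ∈ (complex n m).faces ∧ R.a ≤ p ∧
    (∀ i, 0 < i → i < n → s = ridge n m i → p ∈ R.C) ∧
    ∀ i : Fin n, s = facet n m i → R.b i ≤ p}
  isRelLowerSet_faces := by
    rintro s ⟨hsK, ha, hs1, hs2⟩
    refine ⟨hsK.1, fun t hts ht => ⟨((complex n m).isRelLowerSet_faces hsK).2 hts ht, ha, ?_, ?_⟩⟩
    · rintro i hi hin rfl
      obtain ⟨-, j, hj, hsj⟩ := hsK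
      rcases hts.eq_or_ssubset with h | h
      · exact hs1 i hi hin h.symm
      -- A simplex properly containing a ridge must be a whole facet. It is therefore present only
      -- above some `b j`, hence only inside `C`, where the ridge is already present.
      · have hcard := Finset.card_lt_card h
        rw [card_ridge hin.le] at hcard
        exact R.isUpperSet ((R.c_le ⟨j, hj⟩).trans (hs2 ⟨j, hj⟩ (eq_facet hj hsj hcard))) R.c_mem
    · rintro i rfl
      obtain ⟨-, j, hj, hsj⟩ := hsK
      refine hs2 i (Finset.eq_of_subset_of_card_le hts ?_).symm
      rw [card_facet i.2, ← card_facet hj]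
      exact Finset.card_le_card hsj

variable {m R}

theorem facet_mem_stage_iff {i : Fin n} {p : P} :
    facet n m i ∈ (stage m R p).faces ↔ R.b i ≤ p := by
  refine ⟨fun h => h.2.2.2 i rfl, fun h => ⟨facet_mem n m i.2, ?_, ?_, ?_⟩⟩
  · exact (R.a_le _ R.c_mem).trans ((R.c_le i).trans h)
  · intro j _ hj hij
    exact absurd hij.symm (ridge_ne_facet hj.le i.2)
  · intro j hij
    rwa [Fin.ext (facet_inj i.2 hij)] at h

theorem ridge_mem_stage_iff {i : ℕ} (hi : 0 < i) (hin : i < n) {p : P} :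
    ridge n m i ∈ (stage m R p).faces ↔ p ∈ R.C := by
  refine ⟨fun h => h.2.2.1 i hi hin rfl, fun h => ⟨?_, R.a_le p h, fun _ _ _ _ => h, ?_⟩⟩
  · exact ⟨⟨i, mem_ridge.2 (Or.inl rfl)⟩, i, hin, fun v hv => by
      rw [mem_facet]
      rw [mem_ridge] at hv
      tauto⟩
  · intro j hij
    exact absurd hij (ridge_ne_facet hin.le j.2)

theorem mem_stage_iff {s : Finset ℕ} (hs : s ∈ (complex n m).faces)
    (h1 : ∀ i, 0 < i → i < n → s ≠ ridge n m i) (h2 : ∀ i : Fin n, s ≠ facet n m i) {p : P} :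
    s ∈ (stage m R p).faces ↔ R.a ≤ p :=
  ⟨fun h => h.2.1, fun h => ⟨hs, h, fun i hi hin hsi => absurd hsi (h1 i hi hin),
    fun i hi => absurd hi (h2 i)⟩⟩

variable (m R)

/-- The filtration of the ball given by an arrangement. -/
def filtration (hC : ∃ Q : Finset P, ∀ p, p ∈ R.C ↔ ∃ q ∈ Q, q ≤ p)
    (hb : ∃ p ∈ R.C, ∀ i, R.b i ≤ p) : FiniteFiltration P ℕ where
  K := complex n m
  F := stage m R
  le_K _ _ hs := hs.1
  mono _ _ hpq _ hs := ⟨hs.1, hs.2.1.trans hpq,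
    fun i hi hin hsi => R.isUpperSet hpq (hs.2.2.1 i hi hin hsi),
    fun i hi => (hs.2.2.2 i hi).trans hpq⟩
  exists_eq := by
    obtain ⟨p, hp, hpb⟩ := hb
    exact ⟨p, le_antisymm (fun s hs => hs.1) fun s hs =>
      ⟨hs, R.a_le p hp, fun _ _ _ _ => hp, fun i _ => hpb i⟩⟩
  finite_K := finite_faces n m
  births s hs := by
    by_cases h2 : ∃ i : Fin n, s = facet n m i
    · obtain ⟨i, rfl⟩ := h2
      exact ⟨{R.b i}, fun p => by rw [facet_mem_stage_iff]; simp⟩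
    by_cases h1 : ∃ i, 0 < i ∧ i < n ∧ s = ridge n m i
    · obtain ⟨i, hi, hin, rfl⟩ := h1
      obtain ⟨Q, hQ⟩ := hC
      exact ⟨Q, fun p => by rw [ridge_mem_stage_iff hi hin, hQ]⟩
    · push Not at h1 h2
      exact ⟨{R.a}, fun p => by rw [mem_stage_iff hs h1 h2]; simp⟩

variable {m R} (𝔽 : Type u) [Field 𝔽]

theorem cycles_stage_of_not_le {p : P} (hp : ¬ R.a ≤ p) : cycles 𝔽 (stage m R p) m = ⊥ := by
  refine eq_bot_iff.2 fun x hx => Finsupp.support_eq_empty.1 (Finset.eq_empty_of_forall_notMem ?_)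
  exact fun s hs => hp (hx.1 hs).1.2.1

theorem cycles_stage_of_notMem {p : P} (hp : R.a ≤ p) (hpC : p ∉ R.C) :
    cycles 𝔽 (stage m R p) m = outerCycles n m 𝔽 := by
  unfold cycles outerCycles chains
  congr 2
  ext s
  constructor
  · rintro ⟨hs, hcard⟩
    exact ⟨⟨hs.1, hcard⟩, fun i hi hin hsi => hpC (hs.2.2.1 i hi hin hsi)⟩
  · rintro ⟨⟨hs, hcard⟩, h⟩
    refine ⟨(mem_stage_iff hs h fun i hi => ?_).2 hp, hcard⟩
    rw [hi, card_facet i.2] at hcard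
    omega

theorem cycles_stage_of_mem {p : P} (hpC : p ∈ R.C) :
    cycles 𝔽 (stage m R p) m = cycles 𝔽 (complex n m) m := by
  unfold cycles chains
  congr 2
  ext s
  refine ⟨fun hs => ⟨hs.1.1, hs.2⟩, ?_⟩
  rintro ⟨hs, hcard⟩
  refine ⟨⟨hs, R.a_le p hpC, fun _ _ _ _ => hpC, fun i hi => ?_⟩, hcard⟩
  rw [hi, card_facet i.2] at hcard
  omega

/-- The ball has no `(m + 1)`-simplices besides its facets, so the boundaries at `p` are generated
by the spheres of the facets already born. -/
theorem boundaries_stage (p : P) :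
    boundaries 𝔽 (stage m R p) m =
      Submodule.span 𝔽 ((fun i : Fin n => sphere n m 𝔽 i) '' {i | R.b i ≤ p}) := by
  have h : {s | s ∈ (stage m R p).faces ∧ s.card = m + 1 + 1} =
      (fun i : Fin n => facet n m i) '' {i | R.b i ≤ p} := by
    ext s
    constructor
    · rintro ⟨hs, hcard⟩
      obtain ⟨-, i, hi, hsi⟩ := hs.1
      have hsi' := eq_facet hi hsi hcard.ge
      exact ⟨⟨i, hi⟩, hs.2.2.2 ⟨i, hi⟩ hsi', hsi'.symm⟩
    · rintro ⟨i, hi, rfl⟩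
      exact ⟨facet_mem_stage_iff.2 hi, card_facet i.2⟩
  unfold boundaries chains
  rw [h, Finsupp.supported_eq_span_single, Submodule.map_span, Set.image_image, Set.image_image]
  rfl

theorem cycleSystem : CycleSystem R (fun p => cycles 𝔽 (stage m R p) m)
    (fun p => boundaries 𝔽 (stage m R p) m) (outerCycles n m 𝔽) (cycles 𝔽 (complex n m) m)
    (fun i : Fin n => sphere n m 𝔽 i) (coefficients n m 𝔽) where
  eq_bot _ := cycles_stage_of_not_le 𝔽
  eq_lower _ := cycles_stage_of_notMem 𝔽
  eq_upper _ := cycles_stage_of_mem 𝔽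
  boundaries_eq := boundaries_stage 𝔽
  le := outerCycles_le n m 𝔽
  z_mem i := sphere_mem_cycles 𝔽 i.2
  φ_z := coefficients_sphere 𝔽
  sum_mem := sum_sphere_mem 𝔽
  φ_const _ hx := ⟨_, coefficients_outerCycles 𝔽 hx⟩
  mem_of_φ _ := mem_outerCycles_of_coefficients 𝔽

/-- The homology of the filtration has a generalized persistence diagram. -/
theorem exists_isGPD (hC : ∃ Q : Finset P, ∀ p, p ∈ R.C ↔ ∃ q ∈ Q, q ≤ p)
    (hb : ∃ p ∈ R.C, ∀ i, R.b i ≤ p) :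
    ∃ e : ℤ, IsGPD ((filtration m R hC hb).homology 𝔽 m) (R.diagram e) := by
  have := finite_chains 𝔽 (finite_faces n m) m
  have : Module.Finite 𝔽 (cycles 𝔽 (complex n m) m) :=
    Submodule.finiteDimensional_of_le inf_le_left
  -- The homology functor is by definition the `subquotientFunctor` of cycles and boundaries. The
  -- constant `e` is the dimension of the space of cycles with zero coefficients.
  exact ⟨_, (cycleSystem (m := m) (R := R) 𝔽).isGPD
    (fun _ _ h => cycles_mono ((filtration m R hC hb).mono h) m)
    (fun _ _ h => boundaries_mono ((filtration m R hC hb).mono h) m)⟩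

end Filtration

end PathJoin

/-! ### An arrangement in Euclidean space -/

theorem single_one_le {d : ℕ} {p : Fin d → ℝ} (hp : 0 ≤ p) {k : Fin d} (hk : 1 ≤ p k) :
    Pi.single k 1 ≤ p := by
  intro j
  by_cases h : j = k
  · subst h
    simpa using hk
  · simpa [h] using hp j

/-- The arrangement in `ℝ ^ d` with `a = 0` and `c = (1, …, 1)`, where `C` consists of the points
above a unit vector, and `b i = (1 + i, 1 + n - i, 1, …, 1)`. -/
noncomputable def euclideanArrangement (d n : ℕ) (hd : 2 ≤ d) : Arrangement (Fin d → ℝ) n where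
  a := 0
  c := 1
  C := {p | ∃ k, Pi.single k 1 ≤ p}
  b i := 1 + (Pi.single ⟨0, by omega⟩ (i : ℝ) + Pi.single ⟨1, hd⟩ ((n : ℝ) - i))
  isUpperSet := fun p q hpq ⟨k, hk⟩ => ⟨k, hk.trans hpq⟩
  a_le := fun p ⟨k, hk⟩ => (Pi.single_nonneg.2 zero_le_one).trans hk
  a_notMem := fun ⟨k, hk⟩ => by
    have := hk k
    simp at this
    linarith
  c_mem := ⟨⟨0, by omega⟩, single_one_le zero_le_one le_rfl⟩
  -- A nonnegative point with some coordinate at least `1` lies above a unit vector, so outside `C`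
  -- all coordinates are below `1`.
  le_c p hp hpC k := by
    by_contra hk
    exact hpC ⟨k, single_one_le hp (le_of_not_ge hk)⟩
  exists_le := fun p ⟨k, hk⟩ => ⟨Pi.single k 1, ⟨k, le_rfl⟩, hk, single_one_le zero_le_one le_rfl⟩
  c_le i := by
    have : (i : ℝ) ≤ n := by exact_mod_cast i.2.le
    refine le_add_of_nonneg_right (add_nonneg (Pi.single_nonneg.2 (by positivity))
      (Pi.single_nonneg.2 (by linarith)))
  not_le_c i h := by
    have hi : (i : ℝ) < n := by exact_mod_cast i.2
    -- The first coordinate does not help when `i = 0`. The second exceeds `1` by `n - i`, which is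
    -- positive for every `i < n`.
    have := h ⟨1, hd⟩
    simp only [Pi.add_apply, Pi.one_apply, Pi.single_eq_same, ne_eq, Fin.mk.injEq, one_ne_zero,
      not_false_eq_true, Pi.single_eq_of_ne] at this
    linarith
  eq_of_le i j h := by
    -- The first coordinate gives `i ≤ j` and the second gives `j ≤ i`.
    have h0 := h ⟨0, by omega⟩
    have h1 := h ⟨1, hd⟩
    simp only [Pi.add_apply, Pi.one_apply, Pi.single_eq_same, ne_eq, Fin.mk.injEq, one_ne_zero,
      zero_ne_one, not_false_eq_true, Pi.single_eq_of_ne] at h0 h1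
    have h2 : (i : ℝ) = j := by linarith
    exact Fin.ext (by exact_mod_cast h2)

theorem exists_finset_generating (d n : ℕ) (hd : 2 ≤ d) :
    ∃ Q : Finset (Fin d → ℝ), ∀ p, p ∈ (euclideanArrangement d n hd).C ↔ ∃ q ∈ Q, q ≤ p := by
  classical
  exact ⟨Finset.univ.image fun k => Pi.single k 1, fun p => by
    simp [euclideanArrangement]⟩

theorem exists_forall_b_le (d n : ℕ) (hd : 2 ≤ d) :
    ∃ p ∈ (euclideanArrangement d n hd).C, ∀ i, (euclideanArrangement d n hd).b i ≤ p := by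
  -- A crude bound suffices: each of the two single-coordinate summands of `b i` is at most `n`
  -- everywhere.
  refine ⟨fun _ => 1 + (n + n), ⟨⟨0, by omega⟩, single_one_le (fun _ => ?_) ?_⟩, fun i => ?_⟩
  · simp only [Pi.zero_apply]
    positivity
  · linarith [(Nat.cast_nonneg n : (0 : ℝ) ≤ n)]
  · have hi : (i : ℝ) ≤ n := by exact_mod_cast i.2.le
    have hi0 : (0 : ℝ) ≤ i := Nat.cast_nonneg _
    intro j
    refine add_le_add le_rfl (add_le_add ?_ ?_) <;> rw [Pi.single_apply] <;> split_ifs <;> linarith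

/-! ### Exponential size against linearly many simplices -/

/-- For every `n` there is a `d`-parameter filtration with at least `n` and at most
`n * 2 ^ (m + 2)` simplices whose generalized persistence diagram in degree `m` has a finite
support with at least `2 ^ n - 1` elements. -/
theorem exists_filtration_two_pow_sub_one_le (𝔽 : Type u) [Field 𝔽] (d m n : ℕ) (hd : 2 ≤ d) :
    ∃ (Φ : FiniteFiltration (Fin d → ℝ) ℕ) (dgm : Interval (Fin d → ℝ) → ℤ),
      n ≤ Φ.numSimplices ∧ Φ.numSimplices ≤ n * 2 ^ (m + 2) ∧ IsGPD (Φ.homology 𝔽 m) dgm ∧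
      (Function.support dgm).Finite ∧ 2 ^ n - 1 ≤ (Function.support dgm).ncard := by
  have hC := exists_finset_generating d n hd
  have hb := exists_forall_b_le d n hd
  obtain ⟨e, he⟩ := PathJoin.exists_isGPD (m := m) 𝔽 hC hb
  exact ⟨PathJoin.filtration m (euclideanArrangement d n hd) hC hb, _,
    PathJoin.le_ncard_faces n m, PathJoin.ncard_faces_le n m, he,
    ((euclideanArrangement d n hd).diagram e).hasFiniteSupport,
    (euclideanArrangement d n hd).two_pow_sub_one_le_ncard_support e⟩

/-- The function `2 ^ n - 1` is eventually larger than any polynomial in `n`. -/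
theorem eventually_mul_pow_lt_two_pow_sub_one (C : ℝ) (k : ℕ) :
    ∀ᶠ n : ℕ in Filter.atTop, C * (n : ℝ) ^ k < ((2 ^ n - 1 : ℕ) : ℝ) := by
  have h1 : (fun n : ℕ => (n : ℝ) ^ k) =o[Filter.atTop] fun n : ℕ => (2 : ℝ) ^ n := by
    exact_mod_cast isLittleO_pow_const_const_pow_of_one_lt (R := ℝ) k (r := (2 : ℝ)) (by norm_num)
  have h2 := h1.const_mul_left C
  -- Any factor below `1 / 2` would serve: for `n ≥ 1` one has `2 ^ n - 1 ≥ 2 ^ n / 2 > 2 ^ n / 4`.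
  filter_upwards [h2.bound (by norm_num : (0 : ℝ) < 1 / 4), Filter.eventually_ge_atTop 1]
    with n hn hn1
  have h3 : (2 : ℝ) ≤ 2 ^ n := by
    simpa using pow_le_pow_right₀ (by norm_num : (1 : ℝ) ≤ 2) hn1
  have h4 : ‖(2 : ℝ) ^ n‖ = 2 ^ n := Real.norm_of_nonneg (by positivity)
  rw [h4] at hn
  have h5 := (le_abs_self _).trans hn
  rw [Nat.cast_sub Nat.one_le_two_pow]
  push_cast
  linarith

end MultiPers

theorem mainTheorem1 (𝔽 : Type u) [Field 𝔽] (d m : ℕ) (hd : 2 ≤ d) :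
    ¬ ∃ k : ℕ, ∃ C : ℝ, ∃ N₀ : ℕ,
      ∀ (V : Type) [LinearOrder V] (Φ : MultiPers.FiniteFiltration (Fin d → ℝ) V),
        N₀ ≤ Φ.numSimplices →
        ∀ dgm : MultiPers.Interval (Fin d → ℝ) → ℤ, MultiPers.IsGPD (Φ.homology 𝔽 m) dgm →
          (Function.support dgm).Finite →
          ((Function.support dgm).ncard : ℝ) ≤ C * (Φ.numSimplices : ℝ) ^ k := by
  rintro ⟨k, C, N₀, h⟩
  -- The factor `(2 ^ (m + 2)) ^ k` absorbs the bound of the number of simplices by `n * 2 ^ (m +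
  -- 2)`. The absolute value allows this bound to be substituted even when `C` is negative.
  obtain ⟨n, hn, hN⟩ := ((MultiPers.eventually_mul_pow_lt_two_pow_sub_one
    (|C| * (2 ^ (m + 2)) ^ k) k).and (Filter.eventually_ge_atTop N₀)).exists
  obtain ⟨Φ, dgm, h1, h2, hdgm, hfin, hcard⟩ :=
    MultiPers.exists_filtration_two_pow_sub_one_le 𝔽 d m n hd
  have h3 := h ℕ Φ (hN.trans h1) dgm hdgm hfin
  refine absurd h3 (not_le_of_gt ?_)
  calc C * (Φ.numSimplices : ℝ) ^ k ≤ |C| * (n * 2 ^ (m + 2) : ℝ) ^ k := by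
        gcongr
        · exact le_abs_self C
        · exact_mod_cast h2
    _ = |C| * (2 ^ (m + 2)) ^ k * (n : ℝ) ^ k := by ring
    _ < ((2 ^ n - 1 : ℕ) : ℝ) := hn
    _ ≤ _ := by exact_mod_cast hcard
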